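/- \textbf{Proposition (time-step consistency).} Let $M\in\mathbb{R}^{d\times d}$ and $M_z\in\mathbb{R}^{n\times n}$ be symmetric positive definite, let $V:\mathbb{R}^d\to\mathbb{R}$ and $\xi:\mathbb{R}^d\to\mathbb{R}^n$ be $C^\infty$ with $\nabla V$ and $\xi$ globally Lipschitz, and let $\beta,\bar\nu,k>0$. Write $\nabla\xi$ for the $d\times n$ matrix $(\nabla\xi)_{ji}=\partial\xi_i/\partial q_j$ and, for $\nu>0$, set $$V_{\mathrm{fix},\nu}(q)=\frac1{2\beta}\ln\det\bigl(M+\nu^2\,\nabla\xi(q)\,M_z\,\nabla^T\xi(q)\bigr).$$ Let $\Sigma_\nu$ be the set of states $(p,p^z,q,z)\in\mathbb{R}^d\times\mathbb{R}^n\times\mathbb{R}^d\times\mathbb{R}^n$ with $\xi(q)=z/\nu$ and $\nabla^T\xi(q)M^{-1}p=\frac1\nu M_z^{-1}p^z$. One step $(p_m,p^z_m,q_m,z_m)\mapsto(p_{m+1},p^z_{m+1},q_{m+1},z_{m+1})$ of the IMMP leapfrog (RATTLE) scheme with time step $\delta t>0$ and penalty $\nu$ is given by the equations, with Lagrange multipliers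 $\lambda_{m+1/2},\lambda_{m+1}\in\mathbb{R}^n$, $$\begin{aligned} p_{m+1/2}&=p_m-\tfrac{\delta t}{2}(\nabla V+\nabla V_{\mathrm{fix},\nu})(q_m)-\nabla\xi(q_m)\lambda_{m+1/2}, & p^z_{m+1/2}&=p^z_m+\tfrac1\nu\lambda_{m+1/2},\\ q_{m+1}&=q_m+\delta t\,M^{-1}p_{m+1/2}, & z_{m+1}&=z_m+\delta t\,M_z^{-1}p^z_{m+1/2},\\ \xi(q_{m+1})&=\tfrac1\nu z_{m+1},\\ p_{m+1}&=p_{m+1/2}-\tfrac{\delta t}{2}(\nabla V+\nabla V_{\mathrm{fix},\nu})(q_{m+1})-\nabla\xi(q_{m+1})\lambda_{m+1}, & p^z_{m+1}&=p^z_{m+1/2}+\tfrac1\nu\lambda_{m+1},\\ \nabla^T\xi(q_{m+1})M^{-1}p_{m+1}&=\tfrac1\nu M_z^{-1}p^z_{m+1}. \end{aligned}$$ Let $\nu=\bar\nu\,\delta t^{k}$ and assume that the numerical flow is globally defined: for all sufficiently small $\delta t>0$ there is a map $\Phi_{\delta t}$ such that for every $x\in\Sigma_\nu$ the state $\Phi_{\delta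 t}(x)$ is obtained from $x$ by one step of the scheme. Then the scheme is consistent of order $\min(2,2k)$ with the Hamiltonian dynamics $\dot q=\nabla_pH$, $\dot p=-\nabla_qH$ of $H(p,q)=\frac12p^TM^{-1}p+V(q)$ (no thermostat), in the sense that its trajectories converge uniformly on bounded time intervals at the rate $O(\delta t^{\min(2,2k)})$: for all $T,R$ there are $C$ and $\delta_0>0$ such that, for every $\delta t\in(0,\delta_0)$, every $x_0=(p_0,p^z_0,q_0,z_0)\in\Sigma_\nu$ with $|p_0|,|q_0|\le R$, the solution $(p,q)$ of the Hamiltonian dynamics on $[0,\infty)$ with $(p,q)(0)=(p_0,q_0)$, and every integer $m\ge0$ with $m\,\delta t\le T$, the iterates $(p_m,p^z_m,q_m,z_m)=\Phi_{\delta t}^{m}(x_0)$ satisfy $$|p_m-p(m\,\delta t)|\le C\,\delta t^{\min(2,2k)},\qquad |q_m-q(m\,\delta t)|\le C\,\delta t^{\min(2,2k)}.$$ -/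

import Mathlib

open Filter Topology Set
open scoped Matrix ContDiff NNReal

namespace IMMP

/-- The gradient of a scalar function, as the vector of its partial derivatives. -/
noncomputable def grad {d : ℕ} (f : (Fin d → ℝ) → ℝ) (q : Fin d → ℝ) : Fin d → ℝ :=
  fun j => fderiv ℝ f q (Pi.single j 1)

/-- The `d × n` matrix `∇ξ` of a vector-valued map, `(∇ξ) j i = ∂ξ_i / ∂q_j`. -/
noncomputable def gradMat {d n : ℕ} (ξ : (Fin d → ℝ) → (Fin n → ℝ)) (q : Fin d → ℝ) :
    Matrix (Fin d) (Fin n) ℝ :=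
  Matrix.of fun j i => fderiv ℝ ξ q (Pi.single j 1) i

/-- The original Hamiltonian `H(p,q) = ½ pᵀ M⁻¹ p + V(q)`. -/
noncomputable def hamiltonian {d : ℕ} (M : Matrix (Fin d) (Fin d) ℝ) (V : (Fin d → ℝ) → ℝ)
    (p q : Fin d → ℝ) : ℝ :=
  (1 / 2) * (p ⬝ᵥ (M⁻¹ *ᵥ p)) + V q

/-- `(p, q)` solves Hamilton's equations `q' = ∇_p H`, `p' = -∇_q H` on `[0, ∞)`
(the Langevin equations with zero dissipation and zero fluctuation). -/
def IsHamiltonianTrajectory {d : ℕ} (H : (Fin d → ℝ) → (Fin d → ℝ) → ℝ)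
    (p q : ℝ → (Fin d → ℝ)) : Prop :=
  ∀ t : ℝ, 0 ≤ t →
    HasDerivWithinAt q (grad (fun p' => H p' (q t)) (p t)) (Ici 0) t ∧
    HasDerivWithinAt p (-grad (fun q' => H (p t) q') (q t)) (Ici 0) t

/-- The penalized mass matrix `M_ν(q) = M + ν² ∇ξ M_z ∇ᵀξ`. -/
noncomputable def penalizedMass {d n : ℕ} (M : Matrix (Fin d) (Fin d) ℝ)
    (Mz : Matrix (Fin n) (Fin n) ℝ) (ξ : (Fin d → ℝ) → (Fin n → ℝ)) (ν : ℝ)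
    (q : Fin d → ℝ) : Matrix (Fin d) (Fin d) ℝ :=
  M + ν ^ 2 • (gradMat ξ q * Mz * (gradMat ξ q)ᵀ)

/-- The Fixman corrector `V_fix,ν(q) = (1 / 2β) ln det M_ν(q)`. -/
noncomputable def fixmanPotential {d n : ℕ} (M : Matrix (Fin d) (Fin d) ℝ)
    (Mz : Matrix (Fin n) (Fin n) ℝ) (ξ : (Fin d → ℝ) → (Fin n → ℝ)) (β ν : ℝ)
    (q : Fin d → ℝ) : ℝ :=
  1 / (2 * β) * Real.log (penalizedMass M Mz ξ ν q).det

/-- A state `(p, p_z, q, z)` of the extended system. -/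
structure State (d n : ℕ) where
  p : Fin d → ℝ
  pz : Fin n → ℝ
  q : Fin d → ℝ
  z : Fin n → ℝ

/-- The constrained phase space: the position constraint `ξ(q) = z/ν` and the momentum
constraint `∇ᵀξ(q) M⁻¹ p = (1/ν) M_z⁻¹ p_z` that it implies. -/
def constraintSet {d n : ℕ} (M : Matrix (Fin d) (Fin d) ℝ) (Mz : Matrix (Fin n) (Fin n) ℝ)
    (ξ : (Fin d → ℝ) → (Fin n → ℝ)) (ν : ℝ) : Set (State d n) :=
  {x | ξ x.q = ν⁻¹ • x.z ∧
    (gradMat ξ x.q)ᵀ *ᵥ (M⁻¹ *ᵥ x.p) = ν⁻¹ • (Mz⁻¹ *ᵥ x.pz)}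

/-- One step, from the state `x` to the state `y`, of the leapfrog/Verlet (RATTLE) scheme of the
extended Hamiltonian system with constraints: `ph`, `pzh` are the half-step momenta, and `lamh`,
`lam` are the Lagrange multipliers of the position and of the momentum constraint. -/
def IsLeapfrogStep {d n : ℕ} (M : Matrix (Fin d) (Fin d) ℝ) (Mz : Matrix (Fin n) (Fin n) ℝ)
    (V : (Fin d → ℝ) → ℝ) (ξ : (Fin d → ℝ) → (Fin n → ℝ)) (β ν δt : ℝ)
    (x y : State d n) : Prop :=
  ∃ (ph : Fin d → ℝ) (pzh lamh lam : Fin n → ℝ),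
    ph = x.p - (δt / 2) • (grad V x.q + grad (fixmanPotential M Mz ξ β ν) x.q)
          - gradMat ξ x.q *ᵥ lamh ∧
    pzh = x.pz + ν⁻¹ • lamh ∧
    y.q = x.q + δt • (M⁻¹ *ᵥ ph) ∧
    y.z = x.z + δt • (Mz⁻¹ *ᵥ pzh) ∧
    ξ y.q = ν⁻¹ • y.z ∧
    y.p = ph - (δt / 2) • (grad V y.q + grad (fixmanPotential M Mz ξ β ν) y.q)
          - gradMat ξ y.q *ᵥ lam ∧
    y.pz = pzh + ν⁻¹ • lam ∧
    (gradMat ξ y.q)ᵀ *ᵥ (M⁻¹ *ᵥ y.p) = ν⁻¹ • (Mz⁻¹ *ᵥ y.pz)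

end IMMP

/-! One step of the scheme is a Störmer–Verlet step for `H`, perturbed by `O(δt ν²)`. Two sources
feed the perturbation. The Fixman force is `O(ν²)`, because at `ν = 0` the determinant is `det M`,
constant in `q` (`exists_norm_grad_fixmanPotential_le`). The multipliers are `O(δt ν²)`: by
`multiplier_eq` each equals `ν² M_z` times the change of the constraint velocity over half a step,
and that change is `O(δt)`, up to a term in the multiplier itself that small `ν` absorbs
(`multiplier_bound`). Together these give `exists_leapfrogStep_defect_le`.

The exact flow satisfies the Verlet relations up to `O(δt³)` (`exists_verlet_truncation_error_le`),
so both solutions have defects `O(δt η)` with `η = δt² + ν²`. Stability (`verlet_error_le`) and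
`discrete_gronwall` turn this into a global error `O(η)`, which is `O(δt ^ min 2 (2k))`.

The constants hold only on balls. The exact trajectory stays in a ball of radius `K` on `[0, T]`,
and the iterates stay within radius `K + 1` as long as the error is at most `1`; the error bound
itself, for small `δt`, propagates this condition. -/

namespace IMMP

/-! ### Uniform estimates for smooth functions on balls -/

section Analysis

/-- A continuous function is bounded on balls of a proper space. -/
theorem exists_norm_le_on_ball {E F : Type*} [NormedAddCommGroup E] [ProperSpace E]
    [NormedAddCommGroup F] {f : E → F} (hf : Continuous f) (K : ℝ) :
    ∃ C : ℝ, 0 ≤ C ∧ ∀ x, ‖x‖ ≤ K → ‖f x‖ ≤ C := by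
  obtain ⟨C, hC⟩ := (isCompact_closedBall (0 : E) K).exists_bound_of_continuousOn hf.continuousOn
  exact ⟨max C 0, le_max_right _ _, fun x hx =>
    (hC x (by simpa using hx)).trans (le_max_left _ _)⟩

variable {E F : Type*} [NormedAddCommGroup E] [NormedSpace ℝ E] [NormedAddCommGroup F]
  [NormedSpace ℝ F]

/-- A `C¹` function is Lipschitz on balls of a proper space. -/
theorem exists_lipschitz_on_ball [ProperSpace E] {f : E → F} (hf : ContDiff ℝ 1 f) (K : ℝ) :
    ∃ C : ℝ, 0 ≤ C ∧ ∀ x y, ‖x‖ ≤ K → ‖y‖ ≤ K → ‖f y - f x‖ ≤ C * ‖y - x‖ := by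
  obtain ⟨C, hC0, hC⟩ := exists_norm_le_on_ball (hf.continuous_fderiv one_ne_zero) K
  refine ⟨C, hC0, fun x y hx hy => ?_⟩
  exact (convex_closedBall (0 : E) K).norm_image_sub_le_of_norm_fderiv_le (𝕜 := ℝ)
    (fun z _ => hf.differentiable one_ne_zero z) (fun z hz => hC z (by simpa using hz))
    (by simpa using hx) (by simpa using hy)

/-- First-order Taylor expansion of a `C²` function, with a remainder uniform on balls. -/
theorem exists_taylor_bound_on_ball [ProperSpace E] {f : E → F} (hf : ContDiff ℝ 2 f) (K : ℝ) :
    ∃ C : ℝ, 0 ≤ C ∧ ∀ x y, ‖x‖ ≤ K → ‖y‖ ≤ K →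
      ‖f y - f x - fderiv ℝ f x (y - x)‖ ≤ C * ‖y - x‖ ^ 2 := by
  obtain ⟨C, hC0, hC⟩ := exists_lipschitz_on_ball
    (hf.fderiv_right (m := 1) (by norm_num)) K
  refine ⟨C, hC0, fun x y hx hy => ?_⟩
  have hseg : segment ℝ x y ⊆ Metric.closedBall (0 : E) K :=
    (convex_closedBall (0 : E) K).segment_subset (by simpa using hx) (by simpa using hy)
  -- Mean value inequality for `f` minus its linearization at `x`, whose derivative along the
  -- segment is at most `C * ‖y - x‖`.
  have := (convex_segment x y).norm_image_sub_le_of_norm_fderiv_le' (𝕜 := ℝ) (f := f)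
    (φ := fderiv ℝ f x) (C := C * ‖y - x‖)
    (fun z _ => hf.differentiable two_ne_zero z) (fun z hz => ?_)
    (left_mem_segment ℝ x y) (right_mem_segment ℝ x y)
  · rwa [pow_two, ← mul_assoc]
  · refine (hC x z hx (by simpa using hseg hz)).trans ?_
    gcongr
    exact norm_sub_le_of_mem_segment hz

end Analysis

/-! ### Gradients in coordinates and the sup norm -/

section Vectors

variable {d n : ℕ}

theorem exists_norm_mulVec_le {m n : ℕ} (A : Matrix (Fin m) (Fin n) ℝ) :
    ∃ C : ℝ, 0 ≤ C ∧ ∀ v, ‖A *ᵥ v‖ ≤ C * ‖v‖ :=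
  ⟨‖(Matrix.mulVecLin A).toContinuousLinearMap‖, norm_nonneg _, fun v =>
    (Matrix.mulVecLin A).toContinuousLinearMap.le_opNorm v⟩

theorem norm_single_one_le (j : Fin d) : ‖(Pi.single j 1 : Fin d → ℝ)‖ ≤ 1 := by
  refine (pi_norm_le_iff_of_nonneg zero_le_one).2 fun i => ?_
  by_cases h : i = j
  · subst h; simp
  · simp [h]

theorem norm_grad_le (f : (Fin d → ℝ) → ℝ) (q : Fin d → ℝ) : ‖grad f q‖ ≤ ‖fderiv ℝ f q‖ := by
  refine (pi_norm_le_iff_of_nonneg (norm_nonneg _)).2 fun j => ?_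
  refine ((fderiv ℝ f q).le_opNorm _).trans ?_
  exact mul_le_of_le_one_right (norm_nonneg _) (norm_single_one_le j)

theorem contDiff_grad {f : (Fin d → ℝ) → ℝ} (hf : ContDiff ℝ ∞ f) : ContDiff ℝ ∞ (grad f) :=
  contDiff_pi.2 fun _ => (hf.fderiv_right (m := ∞) (by simp)).clm_apply contDiff_const

theorem gradMat_transpose_mulVec (ξ : (Fin d → ℝ) → (Fin n → ℝ)) (q v : Fin d → ℝ) :
    (gradMat ξ q)ᵀ *ᵥ v = fderiv ℝ ξ q v := by
  conv_rhs => rw [← (Pi.basisFun ℝ (Fin d)).sum_repr v, map_sum]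
  ext i
  simp [Matrix.mulVec, dotProduct, gradMat, mul_comm]

theorem norm_gradMat_mulVec_le {L : ℝ≥0} {ξ : (Fin d → ℝ) → (Fin n → ℝ)}
    (hL : LipschitzWith L ξ) (q : Fin d → ℝ) (v : Fin n → ℝ) :
    ‖gradMat ξ q *ᵥ v‖ ≤ n * L * ‖v‖ := by
  refine (pi_norm_le_iff_of_nonneg (by positivity)).2 fun j => ?_
  calc ‖(gradMat ξ q *ᵥ v) j‖ = ‖∑ i, fderiv ℝ ξ q (Pi.single j 1) i * v i‖ := rfl
    _ ≤ ∑ _i : Fin n, (L : ℝ) * ‖v‖ := by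
      refine norm_sum_le_of_le _ fun i _ => ?_
      rw [norm_mul]
      gcongr
      · calc _ ≤ ‖fderiv ℝ ξ q (Pi.single j 1)‖ := norm_le_pi_norm _ i
          _ ≤ ‖fderiv ℝ ξ q‖ * 1 := by
            refine ((fderiv ℝ ξ q).le_opNorm _).trans ?_
            gcongr
            exact norm_single_one_le j
          _ ≤ L := by rw [mul_one]; exact norm_fderiv_le_of_lipschitz ℝ hL
      · exact norm_le_pi_norm v i
    _ = n * L * ‖v‖ := by simp [mul_assoc]

theorem contDiff_gradMat_apply {ξ : (Fin d → ℝ) → (Fin n → ℝ)} (hξ : ContDiff ℝ ∞ ξ)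
    (j : Fin d) (i : Fin n) : ContDiff ℝ ∞ fun q => gradMat ξ q j i :=
  contDiff_pi.1 ((hξ.fderiv_right (m := ∞) (by simp)).clm_apply contDiff_const) i

/-- Gradient of the Hamiltonian with respect to the momentum. -/
theorem grad_hamiltonian_momentum {M : Matrix (Fin d) (Fin d) ℝ} (hM : M.PosDef)
    (V : (Fin d → ℝ) → ℝ) (p q : Fin d → ℝ) :
    grad (fun p' => hamiltonian M V p' q) p = M⁻¹ *ᵥ p := by
  set A := (Matrix.mulVecLin M⁻¹).toContinuousLinearMap with hA
  have hsymm : (M⁻¹)ᵀ = M⁻¹ := by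
    have := hM.1.inv
    rwa [Matrix.IsHermitian, Matrix.conjTranspose_eq_transpose_of_trivial] at this
  have hderiv : HasFDerivAt (fun p' : Fin d → ℝ => ∑ i, p' i * A p' i)
      (∑ i, (p i • (ContinuousLinearMap.proj i ∘L A) +
        A p i • ContinuousLinearMap.proj i)) p := by
    refine HasFDerivAt.fun_sum fun i _ => ?_
    exact ((ContinuousLinearMap.proj (R := ℝ) (φ := fun _ : Fin d => ℝ) i).hasFDerivAt).mul
      ((ContinuousLinearMap.proj (R := ℝ) (φ := fun _ : Fin d => ℝ) i ∘L A).hasFDerivAt)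
  have hfun : HasFDerivAt (fun p' => hamiltonian M V p' q)
      ((1 / 2 : ℝ) • ∑ i, (p i • (ContinuousLinearMap.proj i ∘L A) +
        A p i • ContinuousLinearMap.proj i)) p :=
    (hderiv.const_mul (1 / 2)).add_const (V q)
  ext j
  rw [grad, hfun.fderiv]
  have h1 : ∑ i, p i * A (Pi.single j 1) i = (M⁻¹ *ᵥ p) j := by
    calc ∑ i, p i * A (Pi.single j 1) i = p ⬝ᵥ (M⁻¹ *ᵥ Pi.single j 1) := rfl
      _ = (p ᵥ* M⁻¹) j := by rw [Matrix.dotProduct_mulVec]; simp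
      _ = (M⁻¹ *ᵥ p) j := by rw [← Matrix.mulVec_transpose, hsymm]
  have h2 : ∑ i, A p i * (Pi.single j 1 : Fin d → ℝ) i = (M⁻¹ *ᵥ p) j := by
    simp [hA, Pi.single_apply]
  simp [Finset.sum_add_distrib] at h1 h2 ⊢
  rw [h1, h2]
  ring

theorem grad_hamiltonian_position (M : Matrix (Fin d) (Fin d) ℝ)
    (V : (Fin d → ℝ) → ℝ) (p q : Fin d → ℝ) :
    grad (fun q' => hamiltonian M V p q') q = grad V q := by
  ext j
  simp only [grad, hamiltonian]
  rw [fderiv_const_add]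

end Vectors

/-! ### Size of the Fixman force -/

section Fixman

variable {d n : ℕ}

theorem det_penalizedMass_pos {M : Matrix (Fin d) (Fin d) ℝ} {Mz : Matrix (Fin n) (Fin n) ℝ}
    (hM : M.PosDef) (hMz : Mz.PosDef) (ξ : (Fin d → ℝ) → (Fin n → ℝ)) {s : ℝ} (hs : 0 ≤ s)
    (q : Fin d → ℝ) : 0 < (M + s • (gradMat ξ q * Mz * (gradMat ξ q)ᵀ)).det := by
  refine (hM.add_posSemidef (Matrix.PosSemidef.smul ?_ hs)).det_pos
  simpa [Matrix.conjTranspose_eq_transpose_of_trivial] using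
    hMz.posSemidef.mul_mul_conjTranspose_same (gradMat ξ q)

/-- Smoothness is joint in `q` and in `s = ν²`, so that the `q`-derivative can be compared with its
value at `s = 0`. -/
theorem contDiff_det_penalizedMass (M : Matrix (Fin d) (Fin d) ℝ) (Mz : Matrix (Fin n) (Fin n) ℝ)
    {ξ : (Fin d → ℝ) → (Fin n → ℝ)} (hξ : ContDiff ℝ ∞ ξ) :
    ContDiff ℝ ∞ fun u : ℝ × (Fin d → ℝ) =>
      (M + u.1 • (gradMat ξ u.2 * Mz * (gradMat ξ u.2)ᵀ)).det := by
  have hG : ∀ j i, ContDiff ℝ ∞ fun u : ℝ × (Fin d → ℝ) => gradMat ξ u.2 j i := fun j i =>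
    (contDiff_gradMat_apply hξ j i).comp contDiff_snd
  simp only [Matrix.det_apply', Matrix.add_apply, Matrix.smul_apply, Matrix.mul_apply,
    Matrix.transpose_apply, smul_eq_mul]
  refine ContDiff.sum fun σ _ => contDiff_const.mul (contDiff_prod fun i _ => ?_)
  refine contDiff_const.add (contDiff_fst.mul (ContDiff.sum fun k _ => ?_))
  exact (ContDiff.sum fun l _ => (hG _ _).mul contDiff_const).mul (hG _ _)

/-- The Fixman force is `O(ν²)`, locally uniformly in the position. -/
theorem exists_norm_grad_fixmanPotential_le {M : Matrix (Fin d) (Fin d) ℝ}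
    {Mz : Matrix (Fin n) (Fin n) ℝ} (hM : M.PosDef) (hMz : Mz.PosDef)
    {ξ : (Fin d → ℝ) → (Fin n → ℝ)} (hξ : ContDiff ℝ ∞ ξ) (β K : ℝ) :
    ∃ C : ℝ, 0 ≤ C ∧ ∀ ν : ℝ, 0 ≤ ν → ν ≤ 1 → ∀ q : Fin d → ℝ, ‖q‖ ≤ K →
      ‖grad (fixmanPotential M Mz ξ β ν) q‖ ≤ C * ν ^ 2 := by
  set P : ℝ × (Fin d → ℝ) → ℝ := fun u =>
    (M + u.1 • (gradMat ξ u.2 * Mz * (gradMat ξ u.2)ᵀ)).det with hP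
  have hPs : ContDiff ℝ ∞ P := contDiff_det_penalizedMass M Mz hξ
  set J : (Fin d → ℝ) →L[ℝ] ℝ × (Fin d → ℝ) := ContinuousLinearMap.inr ℝ ℝ (Fin d → ℝ)
  have hD : ∀ s q, HasFDerivAt (fun q' => P (s, q')) (fderiv ℝ P (s, q) ∘L J) q := fun s q =>
    HasFDerivAt.comp q ((hPs.differentiable (by simp)) (s, q)).hasFDerivAt
      (hasFDerivAt_prodMk_right s q)
  have hDs : ContDiff ℝ 1 fun u => fderiv ℝ P u ∘L J :=
    ((hPs.fderiv_right (m := ∞) (by simp)).clm_comp contDiff_const).of_le (by simp)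
  obtain ⟨C₁, hC₁, hlip⟩ := exists_lipschitz_on_ball hDs (max 1 K)
  have hcpt : IsCompact (Icc (0 : ℝ) 1 ×ˢ Metric.closedBall (0 : Fin d → ℝ) K) :=
    isCompact_Icc.prod (isCompact_closedBall _ _)
  obtain ⟨C₂, hC₂⟩ := hcpt.exists_bound_of_continuousOn (f := fun u => (P u)⁻¹)
    (hPs.continuous.continuousOn.inv₀ fun u hu =>
      (det_penalizedMass_pos hM hMz ξ hu.1.1 u.2).ne')
  refine ⟨|1 / (2 * β)| * (|C₂| * C₁), by positivity, fun ν hν hν1 q hq => ?_⟩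
  have hs : ν ^ 2 ∈ Icc (0 : ℝ) 1 := ⟨by positivity, pow_le_one₀ hν hν1⟩
  have hpos : 0 < P (ν ^ 2, q) := det_penalizedMass_pos hM hMz ξ hs.1 q
  have hfix : HasFDerivAt (fixmanPotential M Mz ξ β ν)
      ((1 / (2 * β)) • ((P (ν ^ 2, q))⁻¹ • (fderiv ℝ P (ν ^ 2, q) ∘L J))) q :=
    ((hD (ν ^ 2) q).log hpos.ne').const_mul _
  -- At `s = 0` the determinant does not depend on `q`; the Lipschitz bound in `s` then yields the
  -- factor `ν²`.
  have hzero : fderiv ℝ P (0, q) ∘L J = 0 := by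
    rw [← (hD 0 q).fderiv]
    simp [hP]
  have hb : ‖fderiv ℝ P (ν ^ 2, q) ∘L J‖ ≤ C₁ * ν ^ 2 := by
    have := hlip (0, q) (ν ^ 2, q)
      (by rw [Prod.norm_mk]; exact max_le (by simp) (hq.trans (le_max_right _ _)))
      (by
        rw [Prod.norm_mk, Real.norm_of_nonneg hs.1]
        exact max_le_max hs.2 hq)
    simpa [hzero, Prod.norm_def, max_eq_left hs.1] using this
  refine (norm_grad_le _ _).trans ?_
  rw [hfix.fderiv, norm_smul, norm_smul, Real.norm_eq_abs]
  calc |1 / (2 * β)| * (‖(P (ν ^ 2, q))⁻¹‖ * ‖fderiv ℝ P (ν ^ 2, q) ∘L J‖)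
      ≤ |1 / (2 * β)| * (|C₂| * (C₁ * ν ^ 2)) := by
        gcongr
        exact (hC₂ (ν ^ 2, q) ⟨hs, by simpa using hq⟩).trans (le_abs_self _)
    _ = _ := by ring

end Fixman

/-! ### Multipliers and defect of one numerical step -/

section NumericalStep

variable {d n : ℕ}

/-- Allows iteration: the hypothesis on `Φ` and the multiplier identities only apply on the
constraint set. -/
theorem IsLeapfrogStep.mem_constraintSet {M : Matrix (Fin d) (Fin d) ℝ}
    {Mz : Matrix (Fin n) (Fin n) ℝ} {V : (Fin d → ℝ) → ℝ} {ξ : (Fin d → ℝ) → (Fin n → ℝ)}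
    {β ν δt : ℝ} {x y : State d n} (h : IsLeapfrogStep M Mz V ξ β ν δt x y) :
    y ∈ constraintSet M Mz ξ ν := by
  obtain ⟨_, _, _, _, _, _, _, _, h1, _, _, h2⟩ := h
  exact ⟨h1, h2⟩

/-- A Lagrange multiplier `l = ν² M_z u`, where the constraint defect `u` is controlled by the step
size and by the momentum increment, itself controlled by the step size and by `l`, is
`O(ν² δt)`. -/
theorem multiplier_bound {ν δt b c e D N l u w : ℝ} (hb : 0 ≤ b) (he : 0 ≤ e)
    (hl0 : 0 ≤ l) (hl : l ≤ ν ^ 2 * (b * u)) (hu : u ≤ δt * c + e * w)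
    (hw : w ≤ δt * D + N * l) (hsmall : ν ^ 2 * (b * e * N) ≤ 1 / 2) :
    l ≤ δt * ν ^ 2 * (2 * b * (c + e * D)) := by
  have h1 : u ≤ δt * c + e * (δt * D + N * l) := hu.trans (by gcongr)
  have h2 : l ≤ ν ^ 2 * (b * (δt * c + e * (δt * D + N * l))) := hl.trans (by gcongr)
  have h3 : ν ^ 2 * (b * e * N) * l ≤ 1 / 2 * l := by gcongr
  linarith

/-- The multiplier shifts `p_z` by `l / ν`, and the constraint velocity sees `p_z` through `M_z⁻¹ /
ν`; inverting both gives the factor `ν²`. -/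
theorem multiplier_eq {Mz : Matrix (Fin n) (Fin n) ℝ} (hMz : Mz.PosDef) {ν : ℝ} (hν : ν ≠ 0)
    {l a b pz : Fin n → ℝ} (ha : a = ν⁻¹ • (Mz⁻¹ *ᵥ pz))
    (hb : b = ν⁻¹ • (Mz⁻¹ *ᵥ (pz + ν⁻¹ • l))) : l = ν ^ 2 • (Mz *ᵥ (b - a)) := by
  have hdet : IsUnit Mz.det := hMz.det_pos.ne'.isUnit
  rw [ha, hb, ← smul_sub, ← Matrix.mulVec_sub, add_sub_cancel_left, Matrix.mulVec_smul,
    Matrix.mulVec_smul, Matrix.mulVec_smul, Matrix.mulVec_mulVec, Matrix.mul_nonsing_inv _ hdet,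
    Matrix.one_mulVec, smul_smul, smul_smul]
  rw [show ν ^ 2 * ν⁻¹ * ν⁻¹ = 1 by field_simp, one_smul]

set_option maxHeartbeats 1000000 in
/-- One step of the scheme is a step of the Störmer–Verlet scheme for the unconstrained
Hamiltonian, up to a perturbation of size `O(δt ν²)`. -/
theorem exists_leapfrogStep_defect_le {M : Matrix (Fin d) (Fin d) ℝ}
    {Mz : Matrix (Fin n) (Fin n) ℝ} (hM : M.PosDef) (hMz : Mz.PosDef)
    {V : (Fin d → ℝ) → ℝ} {ξ : (Fin d → ℝ) → (Fin n → ℝ)}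
    (hV : ContDiff ℝ ∞ V) (hξ : ContDiff ℝ ∞ ξ) {Lξ : ℝ≥0} (hξlip : LipschitzWith Lξ ξ)
    (β K : ℝ) :
    ∃ C ν₀ : ℝ, 0 ≤ C ∧ 0 < ν₀ ∧ ∀ δt ν : ℝ, 0 < δt → δt ≤ 1 → 0 < ν → ν ≤ ν₀ →
      ∀ x ∈ constraintSet M Mz ξ ν, ‖x.p‖ ≤ K → ‖x.q‖ ≤ K →
      ∀ y, IsLeapfrogStep M Mz V ξ β ν δt x y →
        ‖y.q - x.q - δt • (M⁻¹ *ᵥ x.p) + (δt ^ 2 / 2) • (M⁻¹ *ᵥ grad V x.q)‖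
          ≤ C * (δt * ν ^ 2) ∧
        ‖y.p - x.p + (δt / 2) • (grad V x.q + grad V y.q)‖ ≤ C * (δt * ν ^ 2) := by
  obtain ⟨a, ha0, ha⟩ := exists_norm_mulVec_le M⁻¹
  obtain ⟨b, hb0, hb⟩ := exists_norm_mulVec_le Mz
  obtain ⟨G₀, hG₀0, hG₀⟩ := exists_norm_le_on_ball (contDiff_grad hV).continuous K
  obtain ⟨F₀, hF₀0, hF₀⟩ := exists_norm_grad_fixmanPotential_le hM hMz hξ β K
  -- `K₁` will bound the half-step momentum (the factor `2` pays for absorbing half of `‖ph‖`), and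
  -- `K₂` both positions, as `δt ≤ 1`.
  set K₁ : ℝ := 2 * (|K| + G₀ + F₀ + |K| / 2) with hK₁
  have hK₁0 : 0 ≤ K₁ := by positivity
  set K₂ : ℝ := |K| + a * K₁ with hK₂
  obtain ⟨G, hG0, hG⟩ := exists_norm_le_on_ball (contDiff_grad hV).continuous K₂
  obtain ⟨F, hF0, hF⟩ := exists_norm_grad_fixmanPotential_le hM hMz hξ β K₂
  obtain ⟨τ, hτ0, hτ⟩ := exists_taylor_bound_on_ball (contDiff_infty.1 hξ 2) K₂
  set ℓ : ℝ := (Lξ : ℝ) with hℓ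
  have hℓ0 : 0 ≤ ℓ := Lξ.2
  set N : ℝ := n * ℓ with hN
  have hN0 : 0 ≤ N := by positivity
  set Λ : ℝ := 2 * b * (τ * (a * K₁) ^ 2 + ℓ * a * (G + F)) with hΛ
  have hΛ0 : 0 ≤ Λ := by positivity
  have hD : ∀ q v, ‖fderiv ℝ ξ q v‖ ≤ ℓ * ‖v‖ := fun q v =>
    ((fderiv ℝ ξ q).le_opNorm v).trans (by gcongr; exact norm_fderiv_le_of_lipschitz ℝ hξlip)
  have hgm : ∀ q v, ‖gradMat ξ q *ᵥ v‖ ≤ N * ‖v‖ := norm_gradMat_mulVec_le hξlip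
  set B : ℝ := b * (ℓ * a) * N with hB
  have hB0 : 0 ≤ B := by positivity
  -- The threshold on `ν` gives `ν² B ≤ 1/2`, which is what every absorption below needs.
  refine ⟨(1 + a) * (F + 2 * N * Λ), min 1 (1 / (2 * (B + 1))), by positivity, by positivity, ?_⟩
  rintro δt ν hδ hδ1 hν hνle x ⟨hx1, hx2⟩ hxp hxq y
    ⟨ph, pzh, lamh, lam, hph, hpzh, hyq, hyz, hy1, hyp, hypz, hy2⟩
  have hν1 : ν ≤ 1 := hνle.trans (min_le_left _ _)
  have hν2 : ν ^ 2 ≤ 1 := pow_le_one₀ hν.le hν1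
  have hsmall : ν ^ 2 * B ≤ 1 / 2 := by
    have h1 : ν ^ 2 ≤ 1 / (2 * (B + 1)) := by
      calc ν ^ 2 ≤ ν := by nlinarith
        _ ≤ _ := hνle.trans (min_le_right _ _)
    calc ν ^ 2 * B ≤ 1 / (2 * (B + 1)) * B := by gcongr
      _ ≤ 1 / 2 := by rw [div_mul_eq_mul_div, div_le_div_iff₀ (by positivity) (by positivity)]
                      linarith
  have hKabs : K ≤ |K| := le_abs_self K
  -- the constraint defects
  rw [gradMat_transpose_mulVec] at hx2 hy2
  -- The position constraints at both ends act as a momentum constraint at the half step, with the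
  -- difference quotient of `ξ` as constraint velocity.
  have hΔ : δt⁻¹ • (ξ y.q - ξ x.q) = ν⁻¹ • (Mz⁻¹ *ᵥ pzh) := by
    rw [hy1, hx1, hyz, ← smul_sub, add_sub_cancel_left, smul_smul, smul_smul]
    congr 1
    field_simp
  have hlamh := multiplier_eq hMz hν.ne' hx2 (hpzh ▸ hΔ)
  have hlam := multiplier_eq hMz hν.ne' hΔ (hypz ▸ hy2)
  have hnl : ∀ {l u : Fin n → ℝ}, l = ν ^ 2 • (Mz *ᵥ u) → ‖l‖ ≤ ν ^ 2 * (b * ‖u‖) := by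
    rintro l u rfl
    rw [norm_smul, Real.norm_of_nonneg (by positivity)]
    gcongr
    exact hb u
  have hΔq : y.q - x.q = δt • (M⁻¹ *ᵥ ph) := by rw [hyq, add_sub_cancel_left]
  have hΔqn : ‖y.q - x.q‖ ≤ δt * (a * ‖ph‖) := by
    rw [hΔq, norm_smul, Real.norm_of_nonneg hδ.le]
    gcongr
    exact ha ph
  have hfx0 : ‖grad V x.q + grad (fixmanPotential M Mz ξ β ν) x.q‖ ≤ G₀ + F₀ := by
    refine norm_add_le_of_le (hG₀ _ hxq) ((hF₀ ν hν.le hν1 _ hxq).trans ?_)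
    exact mul_le_of_le_one_right hF₀0 hν2
  -- a priori bound on the half-step momentum
  have hphK : ‖ph‖ ≤ K₁ := by
    -- No bound on `y.q` is known yet, so only the global Lipschitz constant of `ξ` may be used, not
    -- the Taylor estimate.
    have h1 : ‖δt⁻¹ • (ξ y.q - ξ x.q)‖ ≤ ℓ * (a * ‖ph‖) := by
      rw [norm_smul, norm_inv, Real.norm_of_nonneg hδ.le, inv_mul_le_iff₀ hδ]
      calc ‖ξ y.q - ξ x.q‖ ≤ ℓ * ‖y.q - x.q‖ := hξlip.norm_sub_le _ _
        _ ≤ ℓ * (δt * (a * ‖ph‖)) := by gcongr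
        _ = _ := by ring
    have h2 : ‖fderiv ℝ ξ x.q (M⁻¹ *ᵥ x.p)‖ ≤ ℓ * (a * |K|) := by
      refine (hD _ _).trans ?_
      gcongr
      exact (ha _).trans (by gcongr; exact hxp.trans hKabs)
    have h3 : ‖lamh‖ ≤ ν ^ 2 * (b * (ℓ * (a * ‖ph‖) + ℓ * (a * |K|))) := by
      refine (hnl hlamh).trans ?_
      gcongr
      exact norm_sub_le_of_le h1 h2
    have h4 : ‖ph‖ ≤ |K| + δt / 2 * (G₀ + F₀) + N * ‖lamh‖ := by
      rw [hph]
      refine norm_sub_le_of_le (norm_sub_le_of_le (hxp.trans hKabs) ?_) (hgm _ _)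
      rw [norm_smul, Real.norm_of_nonneg (by positivity)]
      gcongr
    have h5 : N * ‖lamh‖ ≤ ν ^ 2 * B * (‖ph‖ + |K|) :=
      (mul_le_mul_of_nonneg_left h3 hN0).trans (le_of_eq (by rw [hB]; ring))
    have h6 : ν ^ 2 * B * (‖ph‖ + |K|) ≤ 1 / 2 * (‖ph‖ + |K|) := by gcongr
    have h7 : δt / 2 * (G₀ + F₀) ≤ 1 / 2 * (G₀ + F₀) := by gcongr
    rw [hK₁]
    linarith
  have hΔqn' : ‖y.q - x.q‖ ≤ δt * (a * K₁) := hΔqn.trans (by gcongr)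
  have hK₂le : |K| ≤ K₂ := by rw [hK₂]; linarith [mul_nonneg ha0 hK₁0]
  have hxq₂ : ‖x.q‖ ≤ K₂ := (hxq.trans hKabs).trans hK₂le
  have hyq₂ : ‖y.q‖ ≤ K₂ := by
    calc ‖y.q‖ = ‖x.q + (y.q - x.q)‖ := by rw [add_sub_cancel]
      _ ≤ |K| + δt * (a * K₁) := norm_add_le_of_le (hxq.trans hKabs) hΔqn'
      _ ≤ |K| + 1 * (a * K₁) := by gcongr
      _ = K₂ := by rw [one_mul]
  have hfix : ∀ q : Fin d → ℝ, ‖q‖ ≤ K₂ →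
      ‖-((δt / 2) • grad (fixmanPotential M Mz ξ β ν) q)‖ ≤ δt / 2 * (F * ν ^ 2) := fun q hq => by
    rw [norm_neg, norm_smul, Real.norm_of_nonneg (by positivity)]
    gcongr
    exact hF ν hν.le hν1 q hq
  have hforce : ∀ q : Fin d → ℝ, ‖q‖ ≤ K₂ →
      ‖-((δt / 2) • (grad V q + grad (fixmanPotential M Mz ξ β ν) q))‖ ≤ δt * (G + F) := by
    intro q hq
    rw [norm_neg, norm_smul, Real.norm_of_nonneg (by positivity)]
    gcongr
    · linarith
    · exact norm_add_le_of_le (hG _ hq)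
        ((hF ν hν.le hν1 _ hq).trans (mul_le_of_le_one_right hF0 hν2))
  have hDM : ∀ q v, ‖fderiv ℝ ξ q (M⁻¹ *ᵥ v)‖ ≤ ℓ * a * ‖v‖ := fun q v => by
    refine (hD _ _).trans ?_
    rw [mul_assoc]
    gcongr
    exact ha v
  have htaylor : ∀ r : Fin n → ℝ, ‖r‖ ≤ τ * ‖y.q - x.q‖ ^ 2 →
      ‖δt⁻¹ • r‖ ≤ δt * (τ * (a * K₁) ^ 2) := fun r hr => by
    rw [norm_smul, norm_inv, Real.norm_of_nonneg hδ.le, inv_mul_le_iff₀ hδ]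
    calc ‖r‖ ≤ τ * (δt * (a * K₁)) ^ 2 := hr.trans (by gcongr)
      _ = _ := by ring
  have hδinv : δt⁻¹ • (y.q - x.q) = M⁻¹ *ᵥ ph := by
    rw [hΔq, smul_smul, inv_mul_cancel₀ hδ.ne', one_smul]
  have hsmall' : ν ^ 2 * (b * (ℓ * a) * N) ≤ 1 / 2 := hsmall
  -- the multipliers are `O(δt ν²)`
  have hlamhn : ‖lamh‖ ≤ δt * ν ^ 2 * Λ := by
    refine multiplier_bound hb0 (by positivity) (norm_nonneg _) (hnl hlamh)
      (w := ‖ph - x.p‖) ?_ ?_ hsmall'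
    · have : δt⁻¹ • (ξ y.q - ξ x.q) - fderiv ℝ ξ x.q (M⁻¹ *ᵥ x.p)
          = δt⁻¹ • (ξ y.q - ξ x.q - fderiv ℝ ξ x.q (y.q - x.q))
            + fderiv ℝ ξ x.q (M⁻¹ *ᵥ (ph - x.p)) := by
        rw [smul_sub _ (ξ y.q - ξ x.q), ← map_smul, hδinv, Matrix.mulVec_sub, map_sub]
        abel
      rw [this]
      exact norm_add_le_of_le (htaylor _ (hτ _ _ hxq₂ hyq₂)) (hDM _ _)
    · have : ph - x.p = -((δt / 2) • (grad V x.q + grad (fixmanPotential M Mz ξ β ν) x.q))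
          - gradMat ξ x.q *ᵥ lamh := by rw [hph]; abel
      rw [this]
      exact norm_sub_le_of_le (hforce _ hxq₂) (hgm _ _)
  have hlamn : ‖lam‖ ≤ δt * ν ^ 2 * Λ := by
    refine multiplier_bound hb0 (by positivity) (norm_nonneg _) (hnl hlam)
      (w := ‖y.p - ph‖) ?_ ?_ hsmall'
    -- Mirror image of the first half step: Taylor expansion backwards from `y.q`.
    · have : fderiv ℝ ξ y.q (M⁻¹ *ᵥ y.p) - δt⁻¹ • (ξ y.q - ξ x.q)
          = δt⁻¹ • (ξ x.q - ξ y.q - fderiv ℝ ξ y.q (x.q - y.q))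
            + fderiv ℝ ξ y.q (M⁻¹ *ᵥ (y.p - ph)) := by
        rw [← neg_sub y.q x.q, map_neg, sub_neg_eq_add, smul_add, ← map_smul, hδinv,
          Matrix.mulVec_sub, map_sub, ← neg_sub (ξ y.q) (ξ x.q), smul_neg]
        abel
      rw [this]
      refine norm_add_le_of_le (htaylor _ ?_) (hDM _ _)
      rw [norm_sub_rev y.q]
      exact hτ _ _ hyq₂ hxq₂
    · have : y.p - ph = -((δt / 2) • (grad V y.q + grad (fixmanPotential M Mz ξ β ν) y.q))
          - gradMat ξ y.q *ᵥ lam := by rw [hyp]; abel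
      rw [this]
      exact norm_sub_le_of_le (hforce _ hyq₂) (hgm _ _)
  have hgh : ‖gradMat ξ x.q *ᵥ lamh‖ ≤ N * (δt * ν ^ 2 * Λ) := (hgm _ _).trans (by gcongr)
  have hg1 : ‖gradMat ξ y.q *ᵥ lam‖ ≤ N * (δt * ν ^ 2 * Λ) := (hgm _ _).trans (by gcongr)
  have hNΛ : 0 ≤ N * Λ := by positivity
  have hδν : 0 < δt * ν ^ 2 := by positivity
  constructor
  · have : y.q - x.q - δt • (M⁻¹ *ᵥ x.p) + (δt ^ 2 / 2) • (M⁻¹ *ᵥ grad V x.q)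
        = δt • (M⁻¹ *ᵥ (-((δt / 2) • grad (fixmanPotential M Mz ξ β ν) x.q)
          - gradMat ξ x.q *ᵥ lamh)) := by
      rw [hΔq, hph, smul_add]
      simp only [Matrix.mulVec_sub, Matrix.mulVec_add, Matrix.mulVec_smul, Matrix.mulVec_neg]
      module
    rw [this, norm_smul, Real.norm_of_nonneg hδ.le]
    have h1 : ‖-((δt / 2) • grad (fixmanPotential M Mz ξ β ν) x.q) - gradMat ξ x.q *ᵥ lamh‖
        ≤ (F + 2 * N * Λ) * (δt * ν ^ 2) := by
      refine (norm_sub_le_of_le (hfix _ hxq₂) hgh).trans ?_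
      have := mul_nonneg hF0 hδν.le
      have := mul_nonneg hNΛ hδν.le
      linarith
    calc _ ≤ 1 * (a * ((F + 2 * N * Λ) * (δt * ν ^ 2))) := by
          gcongr
          exact (ha _).trans (by gcongr)
      _ ≤ (1 + a) * (F + 2 * N * Λ) * (δt * ν ^ 2) := by
          have : 0 ≤ (F + 2 * N * Λ) * (δt * ν ^ 2) := by positivity
          linarith
  · have : y.p - x.p + (δt / 2) • (grad V x.q + grad V y.q)
        = -((δt / 2) • grad (fixmanPotential M Mz ξ β ν) x.q) - gradMat ξ x.q *ᵥ lamh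
          + (-((δt / 2) • grad (fixmanPotential M Mz ξ β ν) y.q) - gradMat ξ y.q *ᵥ lam) := by
      rw [hyp, hph]
      module
    rw [this]
    refine (norm_add_le_of_le
      (norm_sub_le_of_le (hfix _ hxq₂) hgh)
      (norm_sub_le_of_le (hfix _ hyq₂) hg1)).trans ?_
    have : 0 ≤ a * ((F + 2 * N * Λ) * (δt * ν ^ 2)) := by positivity
    linarith

end NumericalStep

/-! ### Exact flow: a priori bound, Verlet truncation error, stability -/

section ExactFlow

variable {E : Type*} [NormedAddCommGroup E] [NormedSpace ℝ E]

/-- A priori bound for the solutions of `q' = A p`, `p' = -g(q)` with `g` globally Lipschitz. -/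
theorem exists_trajectory_bound (A : E →L[ℝ] E) {g : E → E} {L : ℝ≥0}
    (hg : LipschitzWith L g) (T R : ℝ) :
    ∃ K : ℝ, ∀ p q : ℝ → E, (∀ t, 0 ≤ t → HasDerivWithinAt q (A (p t)) (Ici 0) t) →
      (∀ t, 0 ≤ t → HasDerivWithinAt p (-g (q t)) (Ici 0) t) → ‖p 0‖ ≤ R → ‖q 0‖ ≤ R →
      ∀ t ∈ Icc 0 T, ‖p t‖ ≤ K ∧ ‖q t‖ ≤ K := by
  refine ⟨gronwallBound |R| (‖A‖ + L) ‖g 0‖ T, fun p q hq hp hp0 hq0 t ht => ?_⟩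
  have hder : ∀ s, 0 ≤ s →
      HasDerivWithinAt (fun s => (p s, q s)) (-g (q s), A (p s)) (Ici 0) s := fun s hs =>
    (hp s hs).prodMk (hq s hs)
  have hb := norm_le_gronwallBound_of_norm_deriv_right_le (f := fun s => (p s, q s))
    (f' := fun s => (-g (q s), A (p s))) (δ := |R|) (K := ‖A‖ + L) (ε := ‖g 0‖) (a := 0) (b := T)
    (fun s hs => (hder s hs.1).continuousWithinAt.mono Icc_subset_Ici_self)
    (fun s hs => (hder s hs.1).mono (Ici_subset_Ici.2 hs.1))
    (max_le (hp0.trans (le_abs_self R)) (hq0.trans (le_abs_self R))) (fun s _ => ?_) t ht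
  · have hmono := gronwallBound_mono (abs_nonneg R) (norm_nonneg (g 0))
      (by positivity : 0 ≤ ‖A‖ + (L : ℝ)) (show t - 0 ≤ T by linarith [ht.2])
    exact ⟨(norm_fst_le (p t, q t)).trans (hb.trans hmono),
      (norm_snd_le (p t, q t)).trans (hb.trans hmono)⟩
  · have h1 : ‖p s‖ ≤ ‖(p s, q s)‖ := norm_fst_le (p s, q s)
    have h2 : ‖q s‖ ≤ ‖(p s, q s)‖ := norm_snd_le (p s, q s)
    have h3 : ‖A (p s)‖ ≤ ‖A‖ * ‖(p s, q s)‖ := (A.le_opNorm _).trans (by gcongr)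
    have h4 : ‖g (q s)‖ ≤ L * ‖(p s, q s)‖ + ‖g 0‖ := by
      have := hg.norm_sub_le (q s) 0
      rw [sub_zero] at this
      calc ‖g (q s)‖ ≤ ‖g (q s) - g 0‖ + ‖g 0‖ := by
            simpa using norm_add_le (g (q s) - g 0) (g 0)
        _ ≤ L * ‖(p s, q s)‖ + ‖g 0‖ := by gcongr; exact this.trans (by gcongr)
    have h5 : 0 ≤ (L : ℝ) * ‖(p s, q s)‖ := by positivity
    have h6 : 0 ≤ ‖A‖ * ‖(p s, q s)‖ := by positivity
    refine max_le ?_ ?_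
    · rw [norm_neg]; linarith
    · linarith [norm_nonneg (g 0)]

theorem norm_sub_le_of_deriv_bound {f f' : ℝ → E} {h C : ℝ} (hC : 0 ≤ C)
    (hf : ∀ s ∈ Icc 0 h, HasDerivWithinAt f (f' s) (Icc 0 h) s)
    (bound : ∀ s ∈ Icc 0 h, ‖f' s‖ ≤ C) : ∀ s ∈ Icc 0 h, ‖f s - f 0‖ ≤ C * h := fun s hs => by
  have := norm_image_sub_le_of_norm_deriv_le_segment' hf
    (fun r hr => bound r (Ico_subset_Icc_self hr)) s hs
  exact this.trans (by gcongr; linarith [hs.2])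

/-- Local truncation error of the Störmer–Verlet scheme. -/
theorem exists_verlet_truncation_error_le [ProperSpace E] (A : E →L[ℝ] E) {g : E → E} {L : ℝ≥0}
    (hg : LipschitzWith L g) (hgs : ContDiff ℝ 2 g) (K : ℝ) :
    ∃ C : ℝ, 0 ≤ C ∧ ∀ p q : ℝ → E, ∀ h : ℝ, 0 ≤ h →
      (∀ s ∈ Icc 0 h, HasDerivWithinAt q (A (p s)) (Icc 0 h) s) →
      (∀ s ∈ Icc 0 h, HasDerivWithinAt p (-g (q s)) (Icc 0 h) s) →
      (∀ s ∈ Icc 0 h, ‖p s‖ ≤ K ∧ ‖q s‖ ≤ K) →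
      ‖q h - q 0 - h • A (p 0) + (h ^ 2 / 2) • A (g (q 0))‖ ≤ C * h ^ 3 ∧
      ‖p h - p 0 + (h / 2) • (g (q 0) + g (q h))‖ ≤ C * h ^ 3 := by
  obtain ⟨G, hG0, hG⟩ := exists_norm_le_on_ball hgs.continuous K
  obtain ⟨τ, hτ0, hτ⟩ := exists_taylor_bound_on_ball hgs K
  set a := ‖A‖ with ha
  have ha0 : 0 ≤ a := norm_nonneg _
  have hL0 : (0 : ℝ) ≤ L := L.2
  set C₁ : ℝ := a * (L * (a * |K|)) with hC₁
  set C₂ : ℝ := τ * (a * |K|) ^ 2 + L * (a * G + a * G) with hC₂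
  refine ⟨C₁ + C₂, by positivity, fun p q h hh hq hp hK => ?_⟩
  have h0 : (0 : ℝ) ∈ Icc 0 h := ⟨le_rfl, hh⟩
  have h1 : h ∈ Icc 0 h := ⟨hh, le_rfl⟩
  have hid : ∀ s, HasDerivWithinAt (fun s : ℝ => s) 1 (Icc 0 h) s := fun s =>
    hasDerivWithinAt_id s _
  have hA : ∀ v c, ‖v‖ ≤ c → ‖A v‖ ≤ a * c := fun v c hv =>
    (A.le_opNorm v).trans (by gcongr)
  have hqinc : ∀ s ∈ Icc 0 h, ‖q s - q 0‖ ≤ a * |K| * h :=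
    norm_sub_le_of_deriv_bound (by positivity) hq
      fun s hs => hA _ _ ((hK s hs).1.trans (le_abs_self K))
  have hpinc : ∀ s ∈ Icc 0 h, ‖p s - p 0‖ ≤ G * h :=
    norm_sub_le_of_deriv_bound hG0 hp fun s hs => by
      rw [norm_neg]; exact hG _ (hK s hs).2
  have hp2 : ∀ s ∈ Icc 0 h, ‖p s - p 0 + s • g (q 0)‖ ≤ L * (a * |K| * h) * h := fun s hs => by
    have := norm_sub_le_of_deriv_bound (f := fun s => p s + s • g (q 0))
      (C := L * (a * |K| * h)) (by positivity)
      (fun s hs => (hp s hs).add ((hid s).smul_const (g (q 0)))) (fun s hs => ?_) s hs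
    · simpa [sub_add_eq_add_sub] using this
    · rw [one_smul, neg_add_eq_sub, norm_sub_rev]
      exact (hg.norm_sub_le _ _).trans (by gcongr; exact hqinc s hs)
  have hq2 : ∀ s ∈ Icc 0 h, ‖q s - q 0 - s • A (p 0)‖ ≤ a * (G * h) * h := fun s hs => by
    have := norm_sub_le_of_deriv_bound (f := fun s => q s - s • A (p 0))
      (C := a * (G * h)) (by positivity)
      (fun s hs => (hq s hs).sub ((hid s).smul_const (A (p 0)))) (fun s hs => ?_) s hs
    · simpa [sub_right_comm] using this
    · rw [one_smul, ← map_sub]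
      exact hA _ _ (hpinc s hs)
  constructor
  -- The defect is the increment of this function over `[0, h]`; its derivative `A (p s - p 0 + s •
  -- g (q 0))` is `O(h²)`.
  · have := norm_sub_le_of_deriv_bound
      (f := fun s => q s - s • A (p 0) + (s ^ 2 / 2) • A (g (q 0)))
      (f' := fun s => A (p s) - (1 : ℝ) • A (p 0) + s • A (g (q 0)))
      (C := a * (L * (a * |K| * h) * h)) (by positivity)
      (fun s hs => ((hq s hs).sub ((hid s).smul_const (A (p 0)))).add
        (HasDerivWithinAt.smul_const ?_ (A (g (q 0))))) (fun s hs => ?_) h h1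
    · have heq : q h - q 0 - h • A (p 0) + (h ^ 2 / 2) • A (g (q 0))
          = q h - h • A (p 0) + (h ^ 2 / 2) • A (g (q 0))
            - (q 0 - (0 : ℝ) • A (p 0) + ((0 : ℝ) ^ 2 / 2) • A (g (q 0))) := by
        module
      rw [heq]
      refine this.trans ?_
      have : 0 ≤ C₂ * h ^ 3 := by positivity
      rw [hC₁]; linarith
    · have hsq := ((hasDerivAt_pow 2 s).div_const 2).hasDerivWithinAt (s := Icc 0 h)
      rwa [show ((2 : ℕ) : ℝ) * s ^ (2 - 1) / 2 = s by norm_num] at hsq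
    · rw [one_smul, ← map_sub, ← map_smul, ← map_add]
      exact hA _ _ (hp2 s hs)
  · have hgd : ∀ s ∈ Icc 0 h, HasDerivWithinAt (fun s => g (q s))
        (fderiv ℝ g (q s) (A (p s))) (Icc 0 h) s := fun s hs =>
      ((hgs.differentiable two_ne_zero) (q s)).hasFDerivAt.comp_hasDerivWithinAt s (hq s hs)
    have := norm_sub_le_of_deriv_bound
      (f := fun s => p s + (s / 2) • (g (q 0) + g (q s)))
      (f' := fun s => -g (q s) + ((s / 2) • fderiv ℝ g (q s) (A (p s))
        + (1 / 2 : ℝ) • (g (q 0) + g (q s))))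
      (C := C₂ * h ^ 2) (by positivity)
      (fun s hs => (hp s hs).add (((hid s).div_const 2).smul ((hgd s hs).const_add _)))
      (fun s hs => ?_) h h1
    · have heq : p h - p 0 + (h / 2) • (g (q 0) + g (q h))
          = p h + (h / 2) • (g (q 0) + g (q h))
            - (p 0 + ((0 : ℝ) / 2) • (g (q 0) + g (q 0))) := by
        module
      rw [heq]
      refine this.trans ?_
      have : 0 ≤ C₁ * h ^ 3 := by positivity
      linarith
    -- The trapezoidal defect's derivative splits into a Taylor remainder of `g` at `q s` and `Dg`
    -- applied to a second-order quantity; no second derivative of `g` is needed.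
    · have heq : -g (q s) + ((s / 2) • fderiv ℝ g (q s) (A (p s))
            + (1 / 2 : ℝ) • (g (q 0) + g (q s)))
          = (1 / 2 : ℝ) • ((g (q 0) - g (q s) - fderiv ℝ g (q s) (q 0 - q s))
            + fderiv ℝ g (q s) (s • A (p s - p 0) - (q s - q 0 - s • A (p 0)))) := by
        simp only [map_sub, map_smul]
        module
      have hb1 : ‖g (q 0) - g (q s) - fderiv ℝ g (q s) (q 0 - q s)‖ ≤ τ * (a * |K| * h) ^ 2 := by
        refine (hτ _ _ (hK s hs).2 (hK 0 h0).2).trans ?_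
        rw [norm_sub_rev]
        gcongr
        exact hqinc s hs
      have hb2 : ‖s • A (p s - p 0) - (q s - q 0 - s • A (p 0))‖
          ≤ h * (a * (G * h)) + a * (G * h) * h := by
        refine norm_sub_le_of_le ?_ (hq2 s hs)
        rw [norm_smul, Real.norm_of_nonneg hs.1]
        gcongr
        · exact hs.2
        · exact hA _ _ (hpinc s hs)
      have hb3 : ‖fderiv ℝ g (q s) (s • A (p s - p 0) - (q s - q 0 - s • A (p 0)))‖
          ≤ L * (h * (a * (G * h)) + a * (G * h) * h) := by
        refine (ContinuousLinearMap.le_opNorm _ _).trans ?_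
        gcongr
        exact norm_fderiv_le_of_lipschitz ℝ hg
      rw [heq, norm_smul]
      have hC : 0 ≤ C₂ * h ^ 2 := by positivity
      have := norm_add_le_of_le hb1 hb3
      calc _ ≤ ‖(1 / 2 : ℝ)‖ * (τ * (a * |K| * h) ^ 2
            + L * (h * (a * (G * h)) + a * (G * h) * h)) := by gcongr
        _ = 1 / 2 * (C₂ * h ^ 2) := by rw [hC₂]; norm_num; ring
        _ ≤ C₂ * h ^ 2 := by linarith

/-- Stability of one Störmer–Verlet step: the error after a step with defects `r`, against a step
with defects `r'`. -/
theorem verlet_error_le (A : E →L[ℝ] E) {g : E → E} {L : ℝ≥0} (hg : LipschitzWith L g)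
    {h ε : ℝ} (hh : 0 ≤ h) (hh1 : h ≤ 1) (hε : 0 ≤ ε) {p q p₁ q₁ P Q P₁ Q₁ : E}
    (hq : ‖q₁ - q - h • A p + (h ^ 2 / 2) • A (g q)‖ ≤ ε)
    (hp : ‖p₁ - p + (h / 2) • (g q + g q₁)‖ ≤ ε)
    (hQ : ‖Q₁ - Q - h • A P + (h ^ 2 / 2) • A (g Q)‖ ≤ ε)
    (hP : ‖P₁ - P + (h / 2) • (g Q + g Q₁)‖ ≤ ε) :
    ‖p₁ - P₁‖ + ‖q₁ - Q₁‖ ≤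
      (1 + (‖A‖ + ‖A‖ * L + L * (2 + ‖A‖ + ‖A‖ * L)) * h) * (‖p - P‖ + ‖q - Q‖)
        + (4 + 2 * L) * ε := by
  set a := ‖A‖
  have ha0 : 0 ≤ a := norm_nonneg _
  have hL0 : (0 : ℝ) ≤ L := L.2
  set x := ‖p - P‖
  set y := ‖q - Q‖
  have hx : 0 ≤ x := norm_nonneg _
  have hy : 0 ≤ y := norm_nonneg _
  have hgq : ‖g q - g Q‖ ≤ L * y := hg.norm_sub_le _ _
  have hgq₁ : ‖g q₁ - g Q₁‖ ≤ L * ‖q₁ - Q₁‖ := hg.norm_sub_le _ _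
  have hAp : ‖h • A (p - P)‖ ≤ h * (a * x) := by
    rw [norm_smul, Real.norm_of_nonneg hh]
    gcongr
    exact A.le_opNorm _
  have hAg : ‖(h ^ 2 / 2) • A (g q - g Q)‖ ≤ h ^ 2 / 2 * (a * (L * y)) := by
    rw [norm_smul, Real.norm_of_nonneg (by positivity)]
    gcongr
    exact (A.le_opNorm _).trans (by gcongr)
  have hgg : ‖(h / 2) • ((g q - g Q) + (g q₁ - g Q₁))‖ ≤ h / 2 * (L * y + L * ‖q₁ - Q₁‖) := by
    rw [norm_smul, Real.norm_of_nonneg (by positivity)]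
    gcongr
    exact norm_add_le_of_le hgq hgq₁
  have hqe : ‖q₁ - Q₁‖ ≤ y + h * (a * x) + h ^ 2 / 2 * (a * (L * y)) + 2 * ε := by
    have heq : q₁ - Q₁ = (q - Q) + h • A (p - P) - (h ^ 2 / 2) • A (g q - g Q)
        + ((q₁ - q - h • A p + (h ^ 2 / 2) • A (g q))
          - (Q₁ - Q - h • A P + (h ^ 2 / 2) • A (g Q))) := by
      simp only [map_sub]
      module
    rw [heq]
    refine (norm_add_le_of_le (norm_sub_le_of_le (norm_add_le_of_le le_rfl hAp) hAg)
      (norm_sub_le_of_le hq hQ)).trans (le_of_eq (by ring))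
  have hpe : ‖p₁ - P₁‖ ≤ x + h / 2 * (L * y + L * ‖q₁ - Q₁‖) + 2 * ε := by
    have heq : p₁ - P₁ = (p - P) - (h / 2) • ((g q - g Q) + (g q₁ - g Q₁))
        + ((p₁ - p + (h / 2) • (g q + g q₁)) - (P₁ - P + (h / 2) • (g Q + g Q₁))) := by
      module
    rw [heq]
    refine (norm_add_le_of_le (norm_sub_le_of_le le_rfl hgg)
      (norm_sub_le_of_le hp hP)).trans (le_of_eq (by ring))
  have hh2 : h ^ 2 / 2 ≤ h := by nlinarith
  have hqe1 : ‖q₁ - Q₁‖ ≤ y + h * (a * x) + h * (a * (L * y)) + 2 * ε :=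
    hqe.trans (by gcongr)
  -- This cruder bound suffices for the force at the new position, which enters the momentum error
  -- with a factor `h`.
  have hqe2 : ‖q₁ - Q₁‖ ≤ (1 + a + a * L) * (x + y) + 2 * ε := by
    have h1 : h * (a * x) ≤ a * x := mul_le_of_le_one_left (by positivity) hh1
    have h2 : h * (a * (L * y)) ≤ a * (L * y) := mul_le_of_le_one_left (by positivity) hh1
    have h3 : 0 ≤ a * y := by positivity
    have h4 : 0 ≤ a * L * x := by positivity
    linarith
  have hpe1 : ‖p₁ - P₁‖ ≤ x + h * (L * y + L * ((1 + a + a * L) * (x + y) + 2 * ε)) + 2 * ε := by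
    refine hpe.trans ?_
    gcongr
    linarith
  have h5 : h * (L * (2 * ε)) ≤ L * (2 * ε) := mul_le_of_le_one_left (by positivity) hh1
  have h6 : 0 ≤ h * (a * y) := by positivity
  have h7 : 0 ≤ h * (a * (L * x)) := by positivity
  have h8 : 0 ≤ h * (L * x) := by positivity
  linarith

end ExactFlow

/-! ### From local to global error -/

section Convergence

theorem HasDerivWithinAt.comp_const_add_Icc {E : Type*} [NormedAddCommGroup E] [NormedSpace ℝ E]
    {f : ℝ → E} {f' : E} {t h s : ℝ} (ht : 0 ≤ t)
    (hf : HasDerivWithinAt f f' (Ici 0) (t + s)) :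
    HasDerivWithinAt (fun r => f (t + r)) f' (Icc 0 h) s := by
  have := hf.scomp s ((hasDerivWithinAt_id s (Icc 0 h)).const_add t)
    (fun r hr => add_nonneg ht hr.1)
  rwa [one_smul] at this

/-- Discrete Grönwall inequality with a step-dependent recursion, valid as long as the error stays
below the threshold `1`. -/
theorem discrete_gronwall {e : ℕ → ℝ} {D h η T : ℝ} (hD : 0 ≤ D) (hη : 0 ≤ η)
    (hh : 0 ≤ h) (he0 : e 0 = 0) (hsmall : Real.exp (D * T) * η ≤ 1)
    (hstep : ∀ m : ℕ, (m + 1 : ℕ) * h ≤ T → e m ≤ 1 → e (m + 1) ≤ (1 + D * h) * e m + D * h * η) :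
    ∀ m : ℕ, m * h ≤ T → e m ≤ Real.exp (D * T) * η := by
  have hexp : ∀ m : ℕ, m * h ≤ T → (Real.exp (D * (m * h)) - 1) * η ≤ Real.exp (D * T) * η :=
    fun m hm => by
      gcongr
      exact (sub_le_self _ zero_le_one).trans (Real.exp_le_exp.2 (by gcongr))
  -- Subtracting `1` makes the induction close: `(1 + Dh)(E - 1) + Dh = (1 + Dh)E - 1`.
  have key : ∀ m : ℕ, m * h ≤ T → e m ≤ (Real.exp (D * (m * h)) - 1) * η := by
    intro m
    induction m with
    | zero => intro _; simp [he0]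
    | succ m ih =>
      intro hm
      have hm' : m * h ≤ T := le_trans (by push_cast; linarith) hm
      refine (hstep m hm ((ih hm').trans ((hexp m hm').trans hsmall))).trans ?_
      have h1 : 1 + D * h ≤ Real.exp (D * h) := by
        rw [add_comm]; exact Real.add_one_le_exp _
      have h2 : Real.exp (D * ((m + 1 : ℕ) * h)) = Real.exp (D * h) * Real.exp (D * (m * h)) := by
        rw [← Real.exp_add]; congr 1; push_cast; ring
      calc (1 + D * h) * e m + D * h * η
          ≤ (1 + D * h) * ((Real.exp (D * (m * h)) - 1) * η) + D * h * η := by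
            gcongr; exact ih hm'
        _ = ((1 + D * h) * Real.exp (D * (m * h)) - 1) * η := by ring
        _ ≤ _ := by rw [h2]; gcongr
  exact fun m hm => (key m hm).trans (hexp m hm)

end Convergence

end IMMP

/-! ### The convergence theorem -/

theorem mainTheorem10 {d n : ℕ}
    (M : Matrix (Fin d) (Fin d) ℝ) (Mz : Matrix (Fin n) (Fin n) ℝ)
    (hM : M.PosDef) (hMz : Mz.PosDef)
    (V : (Fin d → ℝ) → ℝ) (ξ : (Fin d → ℝ) → (Fin n → ℝ))
    (hV : ContDiff ℝ ∞ V) (hξ : ContDiff ℝ ∞ ξ)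
    (LV Lξ : ℝ≥0) (hVlip : LipschitzWith LV (IMMP.grad V)) (hξlip : LipschitzWith Lξ ξ)
    (β νbar k : ℝ) (hβ : 0 < β) (hνbar : 0 < νbar) (hk : 0 < k)
    (Φ : ℝ → IMMP.State d n → IMMP.State d n)
    (hΦ : ∀ᶠ δt in 𝓝[>] (0 : ℝ),
      ∀ x ∈ IMMP.constraintSet M Mz ξ (νbar * δt ^ k),
        IMMP.IsLeapfrogStep M Mz V ξ β (νbar * δt ^ k) δt x (Φ δt x)) :
    ∀ T R : ℝ, ∃ C δ₀ : ℝ, 0 < δ₀ ∧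
      ∀ δt ∈ Ioo 0 δ₀,
      ∀ x₀ ∈ IMMP.constraintSet M Mz ξ (νbar * δt ^ k), ‖x₀.p‖ ≤ R → ‖x₀.q‖ ≤ R →
      ∀ p q : ℝ → (Fin d → ℝ),
        IMMP.IsHamiltonianTrajectory (IMMP.hamiltonian M V) p q →
        p 0 = x₀.p → q 0 = x₀.q →
      ∀ m : ℕ, m * δt ≤ T →
        ‖((Φ δt)^[m] x₀).p - p (m * δt)‖ ≤ C * δt ^ min 2 (2 * k) ∧
        ‖((Φ δt)^[m] x₀).q - q (m * δt)‖ ≤ C * δt ^ min 2 (2 * k) := by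
  intro T R
  set A := (Matrix.mulVecLin M⁻¹).toContinuousLinearMap
  have hgs : ContDiff ℝ 2 (IMMP.grad V) := contDiff_infty.1 (IMMP.contDiff_grad hV) 2
  obtain ⟨K, hK⟩ := IMMP.exists_trajectory_bound A hVlip T R
  obtain ⟨C₁, ν₀, hC₁, hν₀, hnum⟩ :=
    IMMP.exists_leapfrogStep_defect_le hM hMz hV hξ hξlip β (K + 1)
  obtain ⟨C₂, hC₂, hex⟩ := IMMP.exists_verlet_truncation_error_le A hVlip hgs K
  set S : ℝ := ‖A‖ + ‖A‖ * LV + LV * (2 + ‖A‖ + ‖A‖ * LV)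
  have hS : 0 ≤ S := by positivity
  -- A single constant dominates both the stability rate and the defect coefficient, as
  -- `discrete_gronwall` requires.
  set D : ℝ := S + (4 + 2 * LV) * (C₁ + C₂) with hD
  have hD0 : 0 ≤ D := by positivity
  set r : ℝ := min 2 (2 * k)
  have hr : 0 < r := lt_min two_pos (by positivity)
  set C : ℝ := Real.exp (D * T) * (1 + νbar ^ 2) with hC
  have hpow : ∀ s : ℝ, 0 < s → Tendsto (fun δt : ℝ => δt ^ s) (𝓝[>] 0) (𝓝 0) := fun s hs => by
    have := (Real.continuousAt_rpow_const 0 s (Or.inr hs.le)).tendsto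
    rw [Real.zero_rpow hs.ne'] at this
    exact this.mono_left nhdsWithin_le_nhds
  have hev₁ : ∀ᶠ δt in 𝓝[>] (0 : ℝ), νbar * δt ^ k ≤ ν₀ := by
    have := (hpow k hk).const_mul νbar
    rw [mul_zero] at this
    exact this.eventually_le_const hν₀
  have hev₂ : ∀ᶠ δt in 𝓝[>] (0 : ℝ), C * δt ^ r ≤ 1 := by
    have := (hpow r hr).const_mul C
    rw [mul_zero] at this
    exact this.eventually_le_const one_pos
  have hev₃ : ∀ᶠ δt in 𝓝[>] (0 : ℝ), δt ≤ 1 :=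
    ((continuous_id.tendsto (0 : ℝ)).mono_left nhdsWithin_le_nhds).eventually_le_const one_pos
  obtain ⟨δ₀, hδ₀, hall⟩ := mem_nhdsGT_iff_exists_Ioo_subset.1
    (hΦ.and (hev₁.and (hev₂.and hev₃)))
  refine ⟨C, δ₀, hδ₀, fun δt hδt x₀ hx₀ hp0R hq0R p q htraj hp0 hq0 => ?_⟩
  obtain ⟨hstep, hνle, hCle, hδ1⟩ := hall hδt
  have hδ : 0 < δt := hδt.1
  set ν : ℝ := νbar * δt ^ k with hν
  have hνpos : 0 < ν := by positivity
  set η : ℝ := δt ^ 2 + ν ^ 2 with hη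
  have hη0 : 0 ≤ η := by positivity
  have hηle : η ≤ (1 + νbar ^ 2) * δt ^ r := by
    have h1 : δt ^ 2 ≤ δt ^ r := by
      rw [← Real.rpow_two]
      exact Real.rpow_le_rpow_of_exponent_ge hδ hδ1 (min_le_left _ _)
    have h2 : (δt ^ k) ^ 2 ≤ δt ^ r := by
      rw [← Real.rpow_mul_natCast hδ.le, mul_comm]
      exact Real.rpow_le_rpow_of_exponent_ge hδ hδ1 (min_le_right _ _)
    rw [hη, hν, mul_pow, add_mul, one_mul]
    gcongr
  have hbound : Real.exp (D * T) * η ≤ C * δt ^ r := by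
    rw [hC, mul_assoc]
    gcongr
  have hq : ∀ t, 0 ≤ t → HasDerivWithinAt q (A (p t)) (Ici 0) t := fun t ht => by
    have := (htraj t ht).1
    rwa [IMMP.grad_hamiltonian_momentum hM] at this
  have hp : ∀ t, 0 ≤ t → HasDerivWithinAt p (-IMMP.grad V (q t)) (Ici 0) t := fun t ht => by
    have := (htraj t ht).2
    rwa [IMMP.grad_hamiltonian_position] at this
  have hKt := hK p q hq hp (hp0 ▸ hp0R) (hq0 ▸ hq0R)
  have hmem : ∀ m : ℕ, (Φ δt)^[m] x₀ ∈ IMMP.constraintSet M Mz ξ ν := fun m => by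
    induction m with
    | zero => exact hx₀
    | succ m ih =>
      rw [Function.iterate_succ_apply']
      exact (hstep _ ih).mem_constraintSet
  set e : ℕ → ℝ := fun m =>
    ‖((Φ δt)^[m] x₀).p - p (m * δt)‖ + ‖((Φ δt)^[m] x₀).q - q (m * δt)‖ with he
  have herr := IMMP.discrete_gronwall (e := e) (T := T) hD0 hη0 hδ.le
    (by simp [he, hp0, hq0]) (hbound.trans hCle) (fun m hm hem => ?_)
  · intro m hm
    have := (herr m hm).trans hbound
    exact ⟨(le_add_of_nonneg_right (norm_nonneg _)).trans this,
      (le_add_of_nonneg_left (norm_nonneg _)).trans this⟩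
  · set t : ℝ := m * δt with ht
    have ht0 : 0 ≤ t := by positivity
    have hm1 : ((m + 1 : ℕ) : ℝ) * δt = t + δt := by rw [ht]; push_cast; ring
    rw [hm1] at hm
    have hKs : ∀ s ∈ Icc 0 δt, ‖p (t + s)‖ ≤ K ∧ ‖q (t + s)‖ ≤ K := fun s hs =>
      hKt (t + s) ⟨add_nonneg ht0 hs.1, by linarith [hs.2]⟩
    have hKt0 : ‖p t‖ ≤ K ∧ ‖q t‖ ≤ K := by simpa using hKs 0 ⟨le_rfl, hδ.le⟩
    obtain ⟨hQ, hP⟩ := hex (fun s => p (t + s)) (fun s => q (t + s)) δt hδ.le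
      (fun s hs => IMMP.HasDerivWithinAt.comp_const_add_Icc ht0 (hq _ (add_nonneg ht0 hs.1)))
      (fun s hs => IMMP.HasDerivWithinAt.comp_const_add_Icc ht0 (hp _ (add_nonneg ht0 hs.1)))
      hKs
    -- An error at most `1` keeps the iterate in the ball of radius `K + 1` where the one-step
    -- estimate holds.
    have hnear : ∀ {u v : Fin d → ℝ}, ‖u - v‖ ≤ e m → ‖v‖ ≤ K → ‖u‖ ≤ K + 1 := by
      intro u v huv hv
      calc ‖u‖ = ‖v + (u - v)‖ := by rw [add_sub_cancel]
        _ ≤ K + 1 := norm_add_le_of_le hv (huv.trans hem)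
    obtain ⟨hqn, hpn⟩ := hnum δt ν hδ hδ1 hνpos hνle _ (hmem m)
      (hnear (le_add_of_nonneg_right (norm_nonneg _)) hKt0.1)
      (hnear (le_add_of_nonneg_left (norm_nonneg _)) hKt0.2) _ (hstep _ (hmem m))
    rw [← Function.iterate_succ_apply' (Φ δt)] at hqn hpn
    simp only [add_zero] at hQ hP
    have hε₁ : C₁ * (δt * ν ^ 2) ≤ (C₁ + C₂) * (δt * η) := by
      gcongr
      · linarith
      · rw [hη]; linarith [sq_nonneg δt]
    have hε₂ : C₂ * δt ^ 3 ≤ (C₁ + C₂) * (δt * η) := by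
      rw [show δt ^ 3 = δt * δt ^ 2 by ring]
      gcongr
      · linarith
      · rw [hη]; linarith [sq_nonneg ν]
    have hstab := IMMP.verlet_error_le A hVlip hδ.le hδ1
      (by positivity : 0 ≤ (C₁ + C₂) * (δt * η))
      (hqn.trans hε₁) (hpn.trans hε₁) (hQ.trans hε₂) (hP.trans hε₂)
    have hSD : S ≤ D := by rw [hD]; linarith [show 0 ≤ (4 + 2 * (LV : ℝ)) * (C₁ + C₂) by positivity]
    have hem0 : 0 ≤ e m := by positivity
    calc e (m + 1) ≤ (1 + S * δt) * e m + (4 + 2 * LV) * ((C₁ + C₂) * (δt * η)) := by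
          simp only [he, hm1]
          exact hstab
      _ = (1 + S * δt) * e m + (4 + 2 * LV) * (C₁ + C₂) * δt * η := by ring
      _ ≤ (1 + D * δt) * e m + D * δt * η := by
          gcongr
          rw [hD]
          linarith
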